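/- Let $(X,d)$ be a Hadamard space, i.e. a complete metric space such that for all $x_0,x_1\in X$ there is $y\in X$ with $d(z,y)^2\le\frac12 d(z,x_0)^2+\frac12 d(z,x_1)^2-\frac14 d(x_0,x_1)^2$ for all $z\in X$. Let $\mathbf a=(a_i)_{i\in\mathbb Z^s}$ be a mask: a finitely supported family of nonnegative reals with $\sum_{j\in\mathbb Z^s}a_{i-2j}=1$ for every $i\in\mathbb Z^s$. Let $\ell^\infty(\mathbb Z^s,X)$ be the set of bounded maps $x:\mathbb Z^s\to X$, with the metric $d_\infty(x,y)=\sup_i d(x_i,y_i)$. For an initial distribution $\alpha$ on $\mathbb Z^s$, let $X^{\mathbf a}_n(\omega)=\omega_n$ be the characteristic Markov chain of $\mathbf a$: the coordinate process on $\Omega=(\mathbb Z^s)^{\mathbb N_0}$ under the law $\mathbb P_\alpha$ of the Markov chain with initial distribution $\alpha$ and transition matrix $(a_{i-2j})_{i,j\in\mathbb Z^s}$. Put $\mathcal F_n=\sigma(X^{\mathbf a}_0,\dots,X^{\mathbf a}_n)$. For square-integrable $Y:\Omega\to X$ and a sub-$\sigma$-algebra $\mathcal G$, the conditional expectation $E(Y|\mathcal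 G)$ (in the sense of Sturm) is the minimizer of $Z\mapsto E(d^2(Y,Z))$ among the $\mathcal G$-measurable square-integrable maps $Z:\Omega\to X$. For $Y$ that is $\mathcal F_n$-measurable, the filtered conditional expectation along $\mathcal F_0\subseteq\dots\subseteq\mathcal F_N$, where $N\ge n$, is $E(Y|||\mathcal F_0)=E(\cdots E(E(Y|\mathcal F_{N-1})|\mathcal F_{N-2})\cdots|\mathcal F_0)$ (which is $Y$ itself if $N=0$). Theorem. There is exactly one map $S:\ell^\infty(\mathbb Z^s,X)\to\ell^\infty(\mathbb Z^s,X)$ such that, for all $x$ and $i$, the point $(Sx)_i$ minimizes $z\mapsto\sum_{j\in\mathbb Z^s}a_{i-2j}\,d^2(x_j,z)$ over $X$; it is called the barycentric refinement scheme of $\mathbf a$. For every initial distribution $\alpha$, every $x\in\ell^\infty(\mathbb Z^s,X)$ and all integers $N\ge n\ge0$, the filtered conditional expectation of $x\circ X^{\mathbf a}_n$ along $\mathcal F_0\subseteq\dots\subseteq\mathcal F_N$ exists, is unique up to $\mathbb P_\alpha$-almost sure equality, and satisfies $$S^n x\circ X^{\mathbf a}_0=E\big(x\circ X^{\mathbf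 a}_n\,|||\,\mathcal F_0\big)\qquad \mathbb P_\alpha\text{-almost surely}.$$ Moreover, $n\mapsto S^n$ is a nonlinear Markov semigroup on $\ell^\infty(\mathbb Z^s,X)$: $S^0=\mathrm{id}$, $S^{m+n}=S^m\circ S^n$, and $d_\infty(S^nx,S^ny)\le d_\infty(x,y)$ for all $m,n\ge 0$ and all $x,y$. -/

import Mathlib

open MeasureTheory ProbabilityTheory
open scoped ENNReal BoundedContinuousFunction

/-- A global NPC (Hadamard) space: a complete metric space satisfying the Hadamard inequality. -/
def IsHadamard (X : Type*) [MetricSpace X] : Prop :=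
  CompleteSpace X ∧ ∀ x₀ x₁ : X, ∃ y : X, ∀ z : X,
    dist z y ^ 2 ≤ (1 / 2) * dist z x₀ ^ 2 + (1 / 2) * dist z x₁ ^ 2 - (1 / 4) * dist x₀ x₁ ^ 2

/-- The grid `ℤ^s` (with its discrete topology and discrete sigma-algebra). -/
abbrev Grid (s : ℕ) : Type := Fin s → ℤ

/-- `ℓ^∞(ℤ^s, X)`: bounded functions `ℤ^s → X` with the uniform metric. Continuity is automatic,
since the grid is discrete. -/
abbrev LInf (s : ℕ) (X : Type*) [MetricSpace X] : Type _ := Grid s →ᵇ X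

/-- A mask: a nonnegative, finitely supported sequence on `ℤ^s` obeying the basic sum rule. -/
structure Mask (s : ℕ) where
  coeff : Grid s → ℝ
  nonneg : ∀ i, 0 ≤ coeff i
  finite_support : coeff.support.Finite
  sum_rule : ∀ i, ∑ᶠ j, coeff (i - 2 • j) = 1

namespace Mask

variable {s : ℕ} (a : Mask s)

theorem finite_row (i : Grid s) : (fun j => a.coeff (i - 2 • j)).support.Finite := by
  refine a.finite_support.preimage (f := fun j : Grid s => i - 2 • j) ?_
  intro j _ k _ h
  funext t
  have ht := congrFun h t
  simpa using ht

theorem hasSum_row (i : Grid s) :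
    HasSum (fun j => ENNReal.ofReal (a.coeff (i - 2 • j))) 1 := by
  have hs : Summable fun j => a.coeff (i - 2 • j) := summable_of_hasFiniteSupport (a.finite_row i)
  have h1 : ∑' j, a.coeff (i - 2 • j) = 1 := by
    rw [tsum_eq_finsum (a.finite_row i), a.sum_rule i]
  have h2 := ENNReal.ofReal_tsum_of_nonneg (fun j => a.nonneg (i - 2 • j)) hs
  rw [h1, ENNReal.ofReal_one] at h2
  rw [h2]
  exact ENNReal.summable.hasSum

/-- The `i`-th row `j ↦ a_{i-2j}` of the transition matrix, as a probability distribution. -/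
noncomputable def row (i : Grid s) : PMF (Grid s) :=
  ⟨fun j => ENNReal.ofReal (a.coeff (i - 2 • j)), a.hasSum_row i⟩

/-- The Markov kernel on `ℤ^s` with transition matrix `(a_{i-2j})_{i,j}`. -/
noncomputable def transition : Kernel (Grid s) (Grid s) :=
  Kernel.ofFunOfCountable fun i => (a.row i).toMeasure

instance : IsMarkovKernel a.transition :=
  ⟨fun i => inferInstanceAs (IsProbabilityMeasure (a.row i).toMeasure)⟩

/-- The kernel that sends a finite history `(i₀, …, iₙ)` to the distribution
`j ↦ a_{iₙ-2j}` of the next state. -/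
noncomputable def step (n : ℕ) : Kernel ((k : Finset.Iic n) → Grid s) (Grid s) :=
  a.transition.comap (fun h => h ⟨n, Finset.mem_Iic.2 le_rfl⟩) (measurable_pi_apply _)

instance (n : ℕ) : IsMarkovKernel (a.step n) :=
  inferInstanceAs (IsMarkovKernel (a.transition.comap _ _))

/-- The law `ℙ_α`, on the path space `(ℤ^s)^ℕ`, of the characteristic Markov chain of the mask with
initial distribution `α`. The chain itself is the coordinate process `X_n ω = ω n`. -/
noncomputable def chainMeasure (α : Measure (Grid s)) : Measure (ℕ → Grid s) :=
  Kernel.trajMeasure (X := fun _ : ℕ => Grid s) α a.step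

end Mask

/-- The filtration `ℱ_n = σ(X_0, …, X_n)` on path space. -/
def chainFiltration (s : ℕ) : Filtration ℕ (MeasurableSpace.pi : MeasurableSpace (ℕ → Grid s)) :=
  Filtration.piLE

section ConditionalExpectation

variable {Ω X : Type*} [MetricSpace X] {mΩ : MeasurableSpace Ω}

/-- `Y` is a (strongly) `m`-measurable square-integrable map. -/
def MemL2 (m : MeasurableSpace Ω) (μ : Measure[mΩ] Ω) (Y : Ω → X) : Prop :=
  StronglyMeasurable[m] Y ∧ ∃ z : X, ∫⁻ ω, edist (Y ω) z ^ 2 ∂μ < ∞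

/-- `Z` is a version of Sturm's conditional expectation `E(Y | m)`: it minimizes
`Z' ↦ E(d²(Y, Z'))` among the `m`-measurable square-integrable maps. -/
def IsSturmCondExp (m : MeasurableSpace Ω) (μ : Measure[mΩ] Ω) (Y Z : Ω → X) : Prop :=
  MemL2 mΩ μ Y ∧ MemL2 m μ Z ∧
    ∀ Z' : Ω → X, MemL2 m μ Z' →
      ∫⁻ ω, edist (Y ω) (Z ω) ^ 2 ∂μ ≤ ∫⁻ ω, edist (Y ω) (Z' ω) ^ 2 ∂μ

/-- `Z` is a version of the filtered conditional expectation
`E(Y ||| ℱ_0) = E(⋯ E(E(Y | ℱ_{N-1}) | ℱ_{N-2}) ⋯ | ℱ_0)` along `ℱ_0 ⊆ ⋯ ⊆ ℱ_N`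
(no conditioning takes place when `N = 0`). -/
def IsFilteredCondExp (ℱ : Filtration ℕ mΩ) (μ : Measure[mΩ] Ω) :
    ℕ → (Ω → X) → (Ω → X) → Prop
  | 0, Y, Z => Z =ᵐ[μ] Y
  | N + 1, Y, Z => ∃ W : Ω → X, IsSturmCondExp (ℱ N) μ Y W ∧ IsFilteredCondExp ℱ μ N W Z

end ConditionalExpectation

section Subdivision

variable {s : ℕ} {X : Type*} [MetricSpace X]

/-- `S` is a barycentric refinement scheme with mask `a`:
`(S x)_i` is a minimizer of `z ↦ ∑_j a_{i-2j} d²(x_j, z)`. -/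
def IsBarycentricScheme (a : Mask s) (S : LInf s X → LInf s X) : Prop :=
  ∀ (x : LInf s X) (i : Grid s),
    IsMinOn (fun z : X => ∑ᶠ j, a.coeff (i - 2 • j) * dist (x j) z ^ 2) Set.univ (S x i)

/-- A nonlinear Markov semigroup on `ℓ^∞(ℤ^s, X)`: a semigroup `ℕ → Lip₁(ℓ^∞(ℤ^s, X))`. -/
structure IsNonlinearMarkovSemigroup (T : ℕ → LInf s X → LInf s X) : Prop where
  zero : T 0 = id
  add : ∀ m n, T (m + n) = T m ∘ T n
  lipschitz : ∀ n, LipschitzWith 1 (T n)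

end Subdivision

/-! ### Barycenters in Hadamard spaces -/

section HadamardSpace

variable {X : Type*} [MetricSpace X]

/-! The midpoint inequality for d² passes to weighted sums F of squared distances, so F has a
minimizer b, and F(b) + d(b,z)² ≤ F(z) for all z (`MidpointConvexDistSq.add_dist_sq_le`).
Integrating this variance inequality along the chain by the Markov property
(`lintegral_chainMeasure_succ`) shows that (Sx)(X_N) is the conditional expectation of x(X_{N+1})
given ℱ_N, unique almost surely. So each conditioning at a time below n trades one step of the chain
for one application of S, the others do nothing, and induction on N gives the formula.

Variance and quadrilateral inequalities together make barycenters nonexpansive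
(`IsHadamard.dist_barycenter_le`); this gives boundedness of Sx, uniqueness of S and the Lipschitz
bound. -/

/-- The weighted sum of squared distances to the points `x j`. -/
noncomputable def weightedDistSq {ι : Type*} (w : ι → ℝ) (x : ι → X) (z : X) : ℝ :=
  ∑ᶠ j, w j * dist (x j) z ^ 2

/-- A function along which the squared distance is uniformly convex at midpoints. -/
def MidpointConvexDistSq (F : X → ℝ) : Prop :=
  ∀ x₀ x₁ : X, ∃ m : X, dist x₀ m ≤ dist x₀ x₁ / 2 ∧ dist x₁ m ≤ dist x₀ x₁ / 2 ∧
    F m ≤ (1 / 2) * F x₀ + (1 / 2) * F x₁ - (1 / 4) * dist x₀ x₁ ^ 2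

/-- Minimizing sequences are Cauchy: F at a midpoint is at least the infimum, so a quarter of the
squared distance is at most the mean excess of F at the two endpoints. -/
theorem MidpointConvexDistSq.exists_isMinOn [CompleteSpace X] [Nonempty X] {F : X → ℝ}
    (hF : MidpointConvexDistSq F) (hc : Continuous F) (h0 : ∀ z, 0 ≤ F z) :
    ∃ b, IsMinOn F Set.univ b := by
  have hbdd : BddBelow (Set.range F) := ⟨0, by rintro _ ⟨z, rfl⟩; exact h0 z⟩
  have hle : ∀ z, iInf F ≤ F z := fun z => ciInf_le hbdd z
  have hex : ∀ n : ℕ, ∃ u, F u < iInf F + 1 / ((n : ℝ) + 1) := fun n =>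
    exists_lt_of_ciInf_lt (lt_add_of_pos_right _ (by positivity))
  choose u hu using hex
  have hone : Filter.Tendsto (fun n : ℕ => 1 / ((n : ℝ) + 1)) Filter.atTop (nhds 0) :=
    tendsto_one_div_add_atTop_nhds_zero_nat
  have hcauchy : CauchySeq u := by
    refine cauchySeq_of_le_tendsto_0 (fun n : ℕ => Real.sqrt (4 * (1 / ((n : ℝ) + 1)))) ?_ ?_
    · intro n m N hn hm
      obtain ⟨c, -, -, hcF⟩ := hF (u n) (u m)
      apply Real.le_sqrt_of_sq_le
      have h1 : 1 / ((n : ℝ) + 1) ≤ 1 / ((N : ℝ) + 1) := by gcongr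
      have h2 : 1 / ((m : ℝ) + 1) ≤ 1 / ((N : ℝ) + 1) := by gcongr
      linarith [hle c, hu n, hu m]
    · have := (hone.const_mul 4).sqrt
      simpa using this
  obtain ⟨b, hb⟩ := cauchySeq_tendsto_of_complete hcauchy
  refine ⟨b, fun z _ => ?_⟩
  have hlim : F b ≤ iInf F + 0 :=
    le_of_tendsto_of_tendsto' ((hc.tendsto b).comp hb) (tendsto_const_nhds.add hone)
      fun n => (hu n).le
  exact (by simpa using hlim : F b ≤ iInf F).trans (hle z)

/-- The variance inequality. -/
theorem MidpointConvexDistSq.add_dist_sq_le {F : X → ℝ} (hF : MidpointConvexDistSq F) {b : X}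
    (hb : IsMinOn F Set.univ b) (z : X) : F b + dist b z ^ 2 ≤ F z := by
  -- Bootstrap: the bound with constant c, applied at a midpoint of b and z, yields the constant (1
  -- + c)/2 at z. Starting from c = 0 the constants tend to 1.
  have key : ∀ n : ℕ, ∀ z, (1 - (1 / 2 : ℝ) ^ n) * dist b z ^ 2 ≤ F z - F b := by
    intro n
    induction n with
    | zero => intro z; simpa using hb (Set.mem_univ z)
    | succ n ih =>
      intro z
      obtain ⟨m, -, hm, hFm⟩ := hF b z
      have htri := dist_triangle b m z
      rw [dist_comm m z] at htri
      have hm' : dist b z / 2 ≤ dist b m := by linarith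
      have hsq : (dist b z / 2) ^ 2 ≤ dist b m ^ 2 := by gcongr
      have hcoef : 0 ≤ 1 - (1 / 2 : ℝ) ^ n := sub_nonneg.2 (pow_le_one₀ (by norm_num) (by norm_num))
      have h1 := (mul_le_mul_of_nonneg_left hsq hcoef).trans (ih m)
      rw [pow_succ]
      linarith
  have hlim : Filter.Tendsto (fun n : ℕ => (1 - (1 / 2 : ℝ) ^ n) * dist b z ^ 2) Filter.atTop
      (nhds ((1 - 0) * dist b z ^ 2)) :=
    ((tendsto_pow_atTop_nhds_zero_of_lt_one (by norm_num) (by norm_num)).const_sub 1).mul_const _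
  have := le_of_tendsto' hlim fun n => key n z
  linarith

theorem IsHadamard.exists_midpoint (hX : IsHadamard X) (x₀ x₁ : X) :
    ∃ m : X, dist x₀ m ≤ dist x₀ x₁ / 2 ∧ dist x₁ m ≤ dist x₀ x₁ / 2 ∧ ∀ z : X,
      dist z m ^ 2 ≤
        (1 / 2) * dist z x₀ ^ 2 + (1 / 2) * dist z x₁ ^ 2 - (1 / 4) * dist x₀ x₁ ^ 2 := by
  obtain ⟨m, hm⟩ := hX.2 x₀ x₁
  refine ⟨m, abs_le_of_sq_le_sq' ?_ (by positivity) |>.2,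
    abs_le_of_sq_le_sq' ?_ (by positivity) |>.2, hm⟩
  · have := hm x₀
    rw [dist_self] at this
    linarith
  · have := hm x₁
    rw [dist_self, dist_comm x₁ x₀] at this
    linarith

/-- The quadrilateral inequality: the squared diagonals are bounded by the squared sides. -/
theorem IsHadamard.dist_sq_add_dist_sq_le (hX : IsHadamard X) (p q r t : X) :
    dist p r ^ 2 + dist q t ^ 2 ≤
      dist p q ^ 2 + dist q r ^ 2 + dist r t ^ 2 + dist t p ^ 2 := by
  -- Take the midpoint of one diagonal, apply the inequality at the ends of the other, and use (u +
  -- v)² ≤ 2u² + 2v².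
  obtain ⟨m, -, -, hm⟩ := hX.exists_midpoint p r
  have h1 := hm q
  have h2 := hm t
  have h3 : dist q t ^ 2 ≤ (dist q m + dist t m) ^ 2 := by
    gcongr
    exact dist_triangle_right q t m
  rw [dist_comm q p] at h1
  rw [dist_comm t r] at h2
  linarith [sq_nonneg (dist q m - dist t m)]

variable {ι : Type*} {w : ι → ℝ}

theorem weightedDistSq_eq_sum (hfin : w.support.Finite) (x : ι → X) (z : X) :
    weightedDistSq w x z = ∑ j ∈ hfin.toFinset, w j * dist (x j) z ^ 2 := by
  refine finsum_eq_sum_of_support_subset _ fun j hj => ?_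
  simpa using left_ne_zero_of_mul hj

theorem continuous_weightedDistSq (hfin : w.support.Finite) (x : ι → X) :
    Continuous (weightedDistSq w x) := by
  simp_rw [funext (weightedDistSq_eq_sum hfin x)]
  fun_prop

theorem weightedDistSq_nonneg (hw : ∀ j, 0 ≤ w j) (x : ι → X) (z : X) :
    0 ≤ weightedDistSq w x z :=
  finsum_nonneg fun j => mul_nonneg (hw j) (sq_nonneg _)

theorem sum_toFinset_eq_one (hfin : w.support.Finite) (h1 : ∑ᶠ j, w j = 1) :
    ∑ j ∈ hfin.toFinset, w j = 1 := by
  rw [← h1, finsum_eq_sum_of_support_subset]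
  simp

theorem IsHadamard.midpointConvexDistSq_weightedDistSq (hX : IsHadamard X) (hw : ∀ j, 0 ≤ w j)
    (hfin : w.support.Finite) (h1 : ∑ᶠ j, w j = 1) (x : ι → X) :
    MidpointConvexDistSq (weightedDistSq w x) := by
  intro x₀ x₁
  obtain ⟨m, hm₀, hm₁, hm⟩ := hX.exists_midpoint x₀ x₁
  refine ⟨m, hm₀, hm₁, ?_⟩
  simp only [weightedDistSq_eq_sum hfin]
  calc ∑ j ∈ hfin.toFinset, w j * dist (x j) m ^ 2
      ≤ ∑ j ∈ hfin.toFinset, w j * ((1 / 2) * dist (x j) x₀ ^ 2 + (1 / 2) * dist (x j) x₁ ^ 2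
          - (1 / 4) * dist x₀ x₁ ^ 2) :=
        Finset.sum_le_sum fun j _ => mul_le_mul_of_nonneg_left (hm (x j)) (hw j)
    _ = (1 / 2) * ∑ j ∈ hfin.toFinset, w j * dist (x j) x₀ ^ 2
          + (1 / 2) * ∑ j ∈ hfin.toFinset, w j * dist (x j) x₁ ^ 2
          - (1 / 4) * dist x₀ x₁ ^ 2 * ∑ j ∈ hfin.toFinset, w j := by
        simp only [Finset.mul_sum, ← Finset.sum_add_distrib, ← Finset.sum_sub_distrib]
        exact Finset.sum_congr rfl fun j _ => by ring
    _ = _ := by rw [sum_toFinset_eq_one hfin h1, mul_one]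

/-- Barycenters are nonexpansive in the uniform metric. -/
theorem IsHadamard.dist_barycenter_le (hX : IsHadamard X) (hw : ∀ j, 0 ≤ w j)
    (hfin : w.support.Finite) (h1 : ∑ᶠ j, w j = 1) {x y : ι → X} {b c : X}
    (hb : IsMinOn (weightedDistSq w x) Set.univ b) (hc : IsMinOn (weightedDistSq w y) Set.univ c)
    {D : ℝ} (hD : 0 ≤ D) (hxy : ∀ j, dist (x j) (y j) ≤ D) : dist b c ≤ D := by
  -- Each variance inequality is tested at the other barycenter. Their sum has 2 d(b,c)² on the
  -- left, while the quadrilaterals x_j, y_j, c, b cost only D² + d(b,c)².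
  have hvx := (hX.midpointConvexDistSq_weightedDistSq hw hfin h1 x).add_dist_sq_le hb c
  have hvy := (hX.midpointConvexDistSq_weightedDistSq hw hfin h1 y).add_dist_sq_le hc b
  have hsum : weightedDistSq w x c + weightedDistSq w y b ≤
      weightedDistSq w x b + weightedDistSq w y c + (D ^ 2 + dist b c ^ 2) := by
    simp only [weightedDistSq_eq_sum hfin]
    calc _ = ∑ j ∈ hfin.toFinset, w j * (dist (x j) c ^ 2 + dist (y j) b ^ 2) := by
          simp only [mul_add, Finset.sum_add_distrib]
      _ ≤ ∑ j ∈ hfin.toFinset,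
            w j * (dist (x j) b ^ 2 + dist (y j) c ^ 2 + (D ^ 2 + dist b c ^ 2)) := by
          refine Finset.sum_le_sum fun j _ => mul_le_mul_of_nonneg_left ?_ (hw j)
          have hq := hX.dist_sq_add_dist_sq_le (x j) (y j) c b
          have hsq : dist (x j) (y j) ^ 2 ≤ D ^ 2 := by
            gcongr
            exact hxy j
          rw [dist_comm c b, dist_comm b (x j)] at hq
          linarith
      _ = _ := by
          simp only [mul_add, Finset.sum_add_distrib, ← Finset.sum_mul,
            sum_toFinset_eq_one hfin h1, one_mul]
  rw [dist_comm c b] at hvy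
  exact abs_le_of_sq_le_sq' (by linarith) hD |>.2

end HadamardSpace

/-! ### The barycentric refinement scheme -/

section Scheme

variable {s : ℕ} {X : Type*} [MetricSpace X] {a : Mask s}

theorem IsBarycentricScheme.isMinOn {S : LInf s X → LInf s X} (hS : IsBarycentricScheme a S)
    (x : LInf s X) (i : Grid s) :
    IsMinOn (weightedDistSq (fun j => a.coeff (i - 2 • j)) x) Set.univ (S x i) :=
  hS x i

theorem Mask.midpointConvexDistSq (a : Mask s) (hX : IsHadamard X) (x : Grid s → X) (i : Grid s) :
    MidpointConvexDistSq (weightedDistSq (fun j => a.coeff (i - 2 • j)) x) :=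
  hX.midpointConvexDistSq_weightedDistSq (fun _ => a.nonneg _) (a.finite_row i) (a.sum_rule i) x

theorem Mask.isMinOn_const (a : Mask s) (p : X) (i : Grid s) :
    IsMinOn (weightedDistSq (fun j => a.coeff (i - 2 • j)) fun _ => p) Set.univ p := by
  intro z _
  have h0 : weightedDistSq (fun j => a.coeff (i - 2 • j)) (fun _ => p) p = 0 := by
    simp [weightedDistSq]
  exact h0.trans_le (weightedDistSq_nonneg (fun _ => a.nonneg _) _ z)

theorem existsUnique_isBarycentricScheme (hX : IsHadamard X) (a : Mask s) :
    ∃! S : LInf s X → LInf s X, IsBarycentricScheme a S := by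
  have := hX.1
  have hex : ∀ (x : LInf s X) (i : Grid s), ∃ b,
      IsMinOn (weightedDistSq (fun j => a.coeff (i - 2 • j)) x) Set.univ b := by
    intro x i
    have : Nonempty X := ⟨x i⟩
    exact (a.midpointConvexDistSq hX x i).exists_isMinOn
      (continuous_weightedDistSq (a.finite_row i) x)
      (weightedDistSq_nonneg (fun _ => a.nonneg _) x)
  choose b hb using hex
  have hbdd : ∀ (x : LInf s X) (i k : Grid s), dist (b x i) (b x k) ≤
      dist x (BoundedContinuousFunction.const _ (x 0))
        + dist x (BoundedContinuousFunction.const _ (x 0)) := by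
    intro x i k
    -- Compare with the constant family `x 0`, which is its own barycenter.
    have h : ∀ i, dist (b x i) (x 0) ≤ dist x (BoundedContinuousFunction.const _ (x 0)) :=
      fun i => hX.dist_barycenter_le (fun _ => a.nonneg _) (a.finite_row i) (a.sum_rule i)
        (hb x i) (a.isMinOn_const (x 0) i) dist_nonneg
        fun j => BoundedContinuousFunction.dist_coe_le_dist (f := x)
          (g := BoundedContinuousFunction.const _ (x 0)) j
    exact (dist_triangle_right _ _ (x 0)).trans (add_le_add (h i) (h k))
  refine ⟨fun x => BoundedContinuousFunction.mkOfDiscrete (b x) _ (hbdd x), fun x i => hb x i, ?_⟩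
  intro T hT
  ext x i
  refine dist_le_zero.1 ?_
  exact hX.dist_barycenter_le (fun _ => a.nonneg _) (a.finite_row i) (a.sum_rule i)
    (hT.isMinOn x i) (hb x i) le_rfl fun j => (dist_self _).le

theorem IsBarycentricScheme.lipschitzWith_one (hX : IsHadamard X) {S : LInf s X → LInf s X}
    (hS : IsBarycentricScheme a S) : LipschitzWith 1 S :=
  LipschitzWith.mk_one fun x y => (BoundedContinuousFunction.dist_le dist_nonneg).2 fun i =>
    hX.dist_barycenter_le (fun _ => a.nonneg _) (a.finite_row i) (a.sum_rule i)
      (hS.isMinOn x i) (hS.isMinOn y i) dist_nonneg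
      fun j => BoundedContinuousFunction.dist_coe_le_dist j

theorem IsBarycentricScheme.isNonlinearMarkovSemigroup (hX : IsHadamard X)
    {S : LInf s X → LInf s X} (hS : IsBarycentricScheme a S) :
    IsNonlinearMarkovSemigroup (fun n => S^[n]) where
  zero := Function.iterate_zero S
  add := Function.iterate_add S
  lipschitz n := by simpa using (hS.lipschitzWith_one hX).iterate n

/-- The variance inequality for one row of the transition matrix, in integral form. -/
theorem IsBarycentricScheme.lintegral_transition_add_le (hX : IsHadamard X)
    {S : LInf s X → LInf s X} (hS : IsBarycentricScheme a S) (x : LInf s X) (i : Grid s) (z : X) :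
    ∫⁻ j, edist (x j) (S x i) ^ 2 ∂a.transition i + edist (S x i) z ^ 2 ≤
      ∫⁻ j, edist (x j) z ^ 2 ∂a.transition i := by
  have hed : ∀ p q : X, edist p q ^ 2 = ENNReal.ofReal (dist p q ^ 2) := fun p q => by
    rw [edist_dist, ENNReal.ofReal_pow dist_nonneg]
  have hint : ∀ z, ∫⁻ j, edist (x j) z ^ 2 ∂a.transition i =
      ENNReal.ofReal (weightedDistSq (fun j => a.coeff (i - 2 • j)) x z) := by
    intro z
    have hpt : ∀ j, edist (x j) z ^ 2 * a.transition i {j} =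
        ENNReal.ofReal (a.coeff (i - 2 • j) * dist (x j) z ^ 2) := by
      intro j
      have : a.transition i {j} = ENNReal.ofReal (a.coeff (i - 2 • j)) :=
        (a.row i).toMeasure_apply_singleton j (measurableSet_singleton j)
      rw [this, hed, mul_comm, ENNReal.ofReal_mul (a.nonneg _)]
    rw [lintegral_countable', tsum_congr hpt, weightedDistSq_eq_sum (a.finite_row i),
      ENNReal.ofReal_sum_of_nonneg fun j _ => mul_nonneg (a.nonneg _) (sq_nonneg _)]
    refine tsum_eq_sum fun j hj => ?_
    have : a.coeff (i - 2 • j) = 0 := by simpa using hj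
    rw [this, zero_mul, ENNReal.ofReal_zero]
  rw [hint, hint, hed,
    ← ENNReal.ofReal_add (weightedDistSq_nonneg (fun _ => a.nonneg _) x _) (sq_nonneg _)]
  exact ENNReal.ofReal_le_ofReal
    ((a.midpointConvexDistSq hX x i).add_dist_sq_le (hS.isMinOn x i) z)

end Scheme

/-! ### Conditional expectation from a variance inequality -/

section CondExp

variable {Ω X : Type*} [MetricSpace X] {m mΩ : MeasurableSpace Ω} {μ : Measure[mΩ] Ω}

theorem lintegral_edist_sq_congr {Y Y' Z Z' : Ω → X} (hY : Y =ᵐ[μ] Y') (hZ : Z =ᵐ[μ] Z') :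
    ∫⁻ ω, edist (Y ω) (Z ω) ^ 2 ∂μ = ∫⁻ ω, edist (Y' ω) (Z' ω) ^ 2 ∂μ :=
  lintegral_congr_ae <| by filter_upwards [hY, hZ] with ω h1 h2; rw [h1, h2]

theorem ae_eq_of_lintegral_edist_sq_eq_zero {Y Z : Ω → X} (hY : StronglyMeasurable[mΩ] Y)
    (hZ : StronglyMeasurable[mΩ] Z) (h : ∫⁻ ω, edist (Y ω) (Z ω) ^ 2 ∂μ = 0) : Y =ᵐ[μ] Z := by
  rw [lintegral_eq_zero_iff ((hY.edist hZ).measurable.pow_const 2)] at h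
  filter_upwards [h] with ω hω
  simpa using hω

/-- If the variance inequality holds at `Z`, then `Z` is a Sturm conditional expectation. -/
theorem isSturmCondExp_of_variance {Y Z : Ω → X} (hY : MemL2 mΩ μ Y) (hZ : MemL2 m μ Z)
    (hvar : ∀ Z', MemL2 m μ Z' → ∫⁻ ω, edist (Y ω) (Z ω) ^ 2 ∂μ + ∫⁻ ω, edist (Z ω) (Z' ω) ^ 2 ∂μ ≤
      ∫⁻ ω, edist (Y ω) (Z' ω) ^ 2 ∂μ) : IsSturmCondExp m μ Y Z :=
  ⟨hY, hZ, fun Z' hZ' => le_self_add.trans (hvar Z' hZ')⟩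

/-- If the variance inequality holds at `Z`, then every Sturm conditional expectation is a version
of `Z`. -/
theorem IsSturmCondExp.ae_eq_of_variance (hm : m ≤ mΩ) {Y Y' Z W : Ω → X} (hYY' : Y' =ᵐ[μ] Y)
    (hZ : MemL2 m μ Z) (hfin : ∫⁻ ω, edist (Y ω) (Z ω) ^ 2 ∂μ ≠ ∞)
    (hvar : ∀ Z', MemL2 m μ Z' → ∫⁻ ω, edist (Y ω) (Z ω) ^ 2 ∂μ + ∫⁻ ω, edist (Z ω) (Z' ω) ^ 2 ∂μ ≤
      ∫⁻ ω, edist (Y ω) (Z' ω) ^ 2 ∂μ) (hW : IsSturmCondExp m μ Y' W) : W =ᵐ[μ] Z := by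
  obtain ⟨-, hWm, hmin⟩ := hW
  have h := hmin Z hZ
  rw [lintegral_edist_sq_congr hYY' Filter.EventuallyEq.rfl,
    lintegral_edist_sq_congr hYY' Filter.EventuallyEq.rfl] at h
  have h2 : ∫⁻ ω, edist (Y ω) (Z ω) ^ 2 ∂μ + ∫⁻ ω, edist (Z ω) (W ω) ^ 2 ∂μ ≤
      ∫⁻ ω, edist (Y ω) (Z ω) ^ 2 ∂μ + 0 := by
    rw [add_zero]
    exact (hvar W hWm).trans h
  -- Finiteness of the minimal value allows it to be cancelled in `ℝ≥0∞`.
  have h3 := (ENNReal.add_le_add_iff_left hfin).1 h2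
  exact (ae_eq_of_lintegral_edist_sq_eq_zero (hZ.1.mono hm) (hWm.1.mono hm)
    (le_antisymm h3 bot_le)).symm

end CondExp

/-! ### Conditioning along the characteristic chain -/

section MarkovChain

variable {s : ℕ} {X : Type*} [MetricSpace X] {a : Mask s} {α : Measure (Grid s)}
  [IsProbabilityMeasure α]

instance : IsProbabilityMeasure (a.chainMeasure α) :=
  inferInstanceAs (IsProbabilityMeasure (Kernel.trajMeasure (X := fun _ : ℕ => Grid s) α a.step))

theorem chainFiltration_eq_comap (s N : ℕ) :
    chainFiltration s N =
      MeasurableSpace.comap (Preorder.frestrictLe (π := fun _ : ℕ => Grid s) N)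
        MeasurableSpace.pi :=
  Filtration.piLE_eq_comap_frestrictLe N

theorem measurable_frestrictLe_chainFiltration (s N : ℕ) :
    Measurable[chainFiltration s N] (Preorder.frestrictLe (π := fun _ : ℕ => Grid s) N) := by
  rw [chainFiltration_eq_comap]
  exact comap_measurable _

theorem lintegral_edist_sq_coe_lt_top {Ω : Type*} {mΩ : MeasurableSpace Ω} {μ : Measure Ω}
    [IsFiniteMeasure μ] (x y : LInf s X) (f g : Ω → Grid s) :
    ∫⁻ ω, edist (x (f ω)) (y (g ω)) ^ 2 ∂μ < ∞ := by
  have hb : ∀ i k, edist (x i) (y k) ^ 2 ≤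
      ENNReal.ofReal (dist x (BoundedContinuousFunction.const _ (x 0))
        + dist y (BoundedContinuousFunction.const _ (x 0))) ^ 2 := by
    intro i k
    rw [edist_dist]
    gcongr
    exact (dist_triangle_right _ _ (x 0)).trans (add_le_add
      (BoundedContinuousFunction.dist_coe_le_dist (f := x)
        (g := BoundedContinuousFunction.const _ (x 0)) i)
      (BoundedContinuousFunction.dist_coe_le_dist (f := y)
        (g := BoundedContinuousFunction.const _ (x 0)) k))
  calc _ ≤ ∫⁻ _, _ ∂μ := lintegral_mono fun ω => hb (f ω) (g ω)
    _ < ∞ := by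
      rw [lintegral_const]
      exact ENNReal.mul_lt_top (ENNReal.pow_lt_top ENNReal.ofReal_lt_top) (measure_lt_top μ _)

theorem memL2_coordinate (x : LInf s X) {n N : ℕ} (h : n ≤ N) :
    MemL2 (chainFiltration s N) (a.chainMeasure α) fun ω => x (ω n) := by
  refine ⟨?_, x 0, lintegral_edist_sq_coe_lt_top x (BoundedContinuousFunction.const _ (x 0))
    (fun ω : ℕ → Grid s => ω n) fun ω => ω n⟩
  have hx : StronglyMeasurable (x : Grid s → X) := StronglyMeasurable.of_discrete
  have hn : Measurable fun p : (k : Finset.Iic N) → Grid s => p ⟨n, Finset.mem_Iic.2 h⟩ :=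
    measurable_pi_apply _
  exact hx.comp_measurable (hn.comp (measurable_frestrictLe_chainFiltration s N))

theorem memL2_pi_coordinate (x : LInf s X) (n : ℕ) :
    MemL2 MeasurableSpace.pi (a.chainMeasure α) fun ω => x (ω n) :=
  ⟨(memL2_coordinate (a := a) (α := α) x le_rfl).1.mono ((chainFiltration s).le n),
    (memL2_coordinate x le_rfl).2⟩

/-- The Markov property, for integrals. -/
theorem lintegral_chainMeasure_succ (N : ℕ)
    (f : ((k : Finset.Iic N) → Grid s) → Grid s → ℝ≥0∞) :
    ∫⁻ ω, f (Preorder.frestrictLe N ω) (ω (N + 1)) ∂a.chainMeasure α =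
      ∫⁻ ω, ∫⁻ j, f (Preorder.frestrictLe N ω) j ∂a.transition (ω N) ∂a.chainMeasure α := by
  have h := Kernel.map_frestrictLe_trajMeasure_compProd_eq_map_trajMeasure
    (X := fun _ : ℕ => Grid s) (μ₀ := α) (κ := a.step) (a := N)
  -- Finite histories form a countable discrete space, so `f` may be arbitrary.
  have hf : Measurable (fun p : ((k : Finset.Iic N) → Grid s) × Grid s => f p.1 p.2) :=
    Measurable.of_discrete
  have h1 := congrArg (fun ν => ∫⁻ p, f p.1 p.2 ∂ν) h
  rw [Measure.lintegral_compProd hf, lintegral_map Measurable.of_discrete (by fun_prop),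
    lintegral_map hf (by fun_prop)] at h1
  exact h1.symm

/-- The variance inequality for one step of the chain. -/
theorem IsBarycentricScheme.lintegral_chainMeasure_add_le (hX : IsHadamard X)
    {S : LInf s X → LInf s X} (hS : IsBarycentricScheme a S) (x : LInf s X) (N : ℕ)
    (Z : (ℕ → Grid s) → X) (hZ : MemL2 (chainFiltration s N) (a.chainMeasure α) Z) :
    ∫⁻ ω, edist (x (ω (N + 1))) (S x (ω N)) ^ 2 ∂a.chainMeasure α
      + ∫⁻ ω, edist (S x (ω N)) (Z ω) ^ 2 ∂a.chainMeasure α ≤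
        ∫⁻ ω, edist (x (ω (N + 1))) (Z ω) ^ 2 ∂a.chainMeasure α := by
  have hZm := hZ.1
  rw [chainFiltration_eq_comap] at hZm
  -- An ℱ_N-measurable map depends only on the history up to time N; `x 0` is a dummy value off the
  -- range of the restriction map.
  obtain ⟨g, rfl⟩ : ∃ g : ((k : Finset.Iic N) → Grid s) → X,
      Z = g ∘ Preorder.frestrictLe (π := fun _ : ℕ => Grid s) N :=
    ⟨_, (hZm.factorsThrough.extend_comp fun _ => x 0).symm⟩
  have h1 := lintegral_chainMeasure_succ (a := a) (α := α) N
    fun p j => edist (x j) (S x (p ⟨N, Finset.mem_Iic.2 le_rfl⟩)) ^ 2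
  have h2 := lintegral_chainMeasure_succ (a := a) (α := α) N fun p j => edist (x j) (g p) ^ 2
  have hmeas : Measurable fun ω : ℕ → Grid s =>
      edist (S x (ω N)) ((g ∘ Preorder.frestrictLe (π := fun _ : ℕ => Grid s) N) ω) ^ 2 :=
    ((memL2_pi_coordinate (a := a) (α := α) (S x) N).1.edist
      (hZ.1.mono ((chainFiltration s).le N))).measurable.pow_const 2
  refine (congrArg (· + _) h1).trans_le ?_
  refine (lintegral_add_right _ hmeas).symm.trans_le ?_
  refine le_trans ?_ h2.symm.le
  exact lintegral_mono fun ω => hS.lintegral_transition_add_le hX x (ω N) _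

theorem isSturmCondExp_of_le (x : LInf s X) {n N : ℕ} (h : n ≤ N) :
    IsSturmCondExp (chainFiltration s N) (a.chainMeasure α) (fun ω => x (ω n))
      fun ω => x (ω n) :=
  isSturmCondExp_of_variance (memL2_pi_coordinate x n) (memL2_coordinate x h) (by simp)

theorem IsBarycentricScheme.isSturmCondExp (hX : IsHadamard X) {S : LInf s X → LInf s X}
    (hS : IsBarycentricScheme a S) (x : LInf s X) (N : ℕ) :
    IsSturmCondExp (chainFiltration s N) (a.chainMeasure α) (fun ω => x (ω (N + 1)))
      fun ω => S x (ω N) :=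
  isSturmCondExp_of_variance (memL2_pi_coordinate x _) (memL2_coordinate (S x) le_rfl)
    (hS.lintegral_chainMeasure_add_le hX x N)

theorem IsBarycentricScheme.isFilteredCondExp (hX : IsHadamard X) {S : LInf s X → LInf s X}
    (hS : IsBarycentricScheme a S) (N : ℕ) : ∀ (x : LInf s X) (n : ℕ), n ≤ N →
      IsFilteredCondExp (chainFiltration s) (a.chainMeasure α) N
        (fun ω => x (ω n)) (fun ω => (S^[n] x) (ω 0)) := by
  induction N with
  | zero =>
    intro x n hn
    obtain rfl : n = 0 := by omega
    exact Filter.EventuallyEq.rfl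
  | succ N ih =>
    intro x n hn
    rcases Nat.le_succ_iff.1 hn with h | rfl
    -- If n ≤ N the conditioning is idle; if n = N + 1 it replaces x by `S x` at time N, which is
    -- why x is quantified inside the induction.
    · exact ⟨_, isSturmCondExp_of_le x h, ih x n h⟩
    · exact ⟨_, hS.isSturmCondExp hX x N, ih (S x) N le_rfl⟩

/-- Each intermediate conditional expectation is known only almost surely, so the induction must
allow Y to be any version of x(X_n). -/
theorem IsBarycentricScheme.ae_eq_of_isFilteredCondExp (hX : IsHadamard X)
    {S : LInf s X → LInf s X} (hS : IsBarycentricScheme a S) (N : ℕ) :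
    ∀ (x : LInf s X) (n : ℕ), n ≤ N → ∀ Y Z : (ℕ → Grid s) → X,
      (Y =ᵐ[a.chainMeasure α] fun ω => x (ω n)) →
      IsFilteredCondExp (chainFiltration s) (a.chainMeasure α) N Y Z →
      Z =ᵐ[a.chainMeasure α] fun ω => (S^[n] x) (ω 0) := by
  induction N with
  | zero =>
    intro x n hn Y Z hY hZ
    obtain rfl : n = 0 := by omega
    exact Filter.EventuallyEq.trans hZ hY
  | succ N ih =>
    rintro x n hn Y Z hY ⟨W, hW, hZ⟩
    have hm := (chainFiltration s).le N
    rcases Nat.le_succ_iff.1 hn with h | rfl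
    · exact ih x n h W Z (hW.ae_eq_of_variance hm hY (memL2_coordinate x h) (by simp) (by simp)) hZ
    · exact ih (S x) N le_rfl W Z (hW.ae_eq_of_variance hm hY (memL2_coordinate (S x) le_rfl)
        (lintegral_edist_sq_coe_lt_top x (S x) (fun ω : ℕ → Grid s => ω (N + 1)) fun ω => ω N).ne
        (hS.lintegral_chainMeasure_add_le hX x N)) hZ

end MarkovChain

theorem mainTheorem2 {s : ℕ} {X : Type*} [MetricSpace X] (hX : IsHadamard X) (a : Mask s) :
    (∃! S : LInf s X → LInf s X, IsBarycentricScheme a S) ∧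
    ∀ S : LInf s X → LInf s X, IsBarycentricScheme a S →
      (∀ (α : Measure (Grid s)) [IsProbabilityMeasure α] (x : LInf s X) (n N : ℕ), n ≤ N →
        IsFilteredCondExp (chainFiltration s) (a.chainMeasure α) N
          (fun ω => x (ω n)) (fun ω => (S^[n] x) (ω 0)) ∧
        ∀ Z : (ℕ → Grid s) → X,
          IsFilteredCondExp (chainFiltration s) (a.chainMeasure α) N (fun ω => x (ω n)) Z →
          Z =ᵐ[a.chainMeasure α] fun ω => (S^[n] x) (ω 0)) ∧
      IsNonlinearMarkovSemigroup (fun n => S^[n]) :=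
  ⟨existsUnique_isBarycentricScheme hX a, fun _ hS =>
    ⟨fun _ _ x n N hn => ⟨hS.isFilteredCondExp hX N x n hn, fun Z hZ =>
      hS.ae_eq_of_isFilteredCondExp hX N x n hn _ Z Filter.EventuallyEq.rfl hZ⟩,
    hS.isNonlinearMarkovSemigroup hX⟩⟩
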